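/- Let $|k\rangle$, $k\in\mathbb N=\{0,1,2,\dots\}$, be the Fock basis of the Hilbert space $\mathcal H$ of a single bosonic mode, and for $\alpha\in\mathbb C$ let $$|\alpha\rangle = e^{-|\alpha|^2/2}\sum_{k=0}^\infty \frac{\alpha^k}{\sqrt{k!}}\,|k\rangle$$ be the corresponding coherent state. A measure-and-prepare channel is a map $\Lambda(X)=\sum_\ell \operatorname{Tr}[X E_\ell]\,\rho_\ell$, where $(E_\ell)_\ell$ is a discrete POVM on $\mathcal H$ (finitely or countably many positive bounded operators that sum weakly to $\mathbb 1$) and the $\rho_\ell$ are density operators on $\mathcal H$. For a probability measure $p$ on $\mathbb C$, let $$F_{c\ell}(p)=\sup_{\Lambda}\int_{\mathbb C} \operatorname{Tr}\big[\Lambda(|\alpha\rangle\langle\alpha|)\,|\alpha\rangle\langle\alpha|\big]\,dp(\alpha),$$ where the supremum is over all measure-and-prepare channels $\Lambda$; this is the classical fidelity for teleporting coherent states distributed according to $p$. (1) Let $p$ be a probability measure on $\mathbb C$ that is phase-invariant, i.e. invariant under $\alpha\mapsto e^{i\varphi}\alpha$ for all $\varphi\in\mathbb R$. Then $$F_{c\ell}(p)\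 \le\ \inf_q\ \sup_{N\in\mathbb N}\ \mu_N\sum_{k=0}^N\frac{1}{q_k}\binom Nk\ \le\ \sup_{N\in\mathbb N}\ \mu_N\sum_{k=0}^N\frac1{\nu_k}\binom Nk ,$$ where the infimum is over all probability distributions $q$ on $\mathbb N$, $$\mu_N=\frac1{N!}\int_{\mathbb C} e^{-2|\alpha|^2}|\alpha|^{2N}\,dp(\alpha),\qquad \nu_k=\frac1{k!}\int_{\mathbb C} e^{-|\alpha|^2}|\alpha|^{2k}\,dp(\alpha),$$ and the expressions take values in $[0,\infty]$ with $1/0=\infty$ and $0\cdot\infty=0$. (2) In particular, for $\lambda>0$ let $p_\lambda$ be the probability measure with density $\frac\lambda\pi e^{-\lambda|\alpha|^2}$ with respect to Lebesgue measure $d^2\alpha$ on $\mathbb C$. It is phase-invariant, both upper bounds in (1) are equal to $\frac{1+\lambda}{2+\lambda}$, and they are attained: $$F_{c\ell}(p_\lambda)=\frac{1+\lambda}{2+\lambda}.$$ -/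

import Mathlib

open MeasureTheory
open scoped ENNReal

noncomputable section

namespace CoherentTeleportation

/-- The Hilbert space of a single bosonic mode, in its Fock representation `ℓ²(ℕ)`. -/
abbrev FockSpace : Type := lp (fun _ : ℕ => ℂ) 2

/-- Bounded operators on the Fock space. -/
abbrev Operator : Type := FockSpace →L[ℂ] FockSpace

/-- The Fock state `|k⟩`. -/
def fock (k : ℕ) : FockSpace := lp.single 2 k (1 : ℂ)

/-- The coefficient `e^{-|α|²/2} α^k / √(k!)` of `|k⟩` in the coherent state `|α⟩`. -/
def coherentCoeff (α : ℂ) (k : ℕ) : ℂ :=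
  (Real.exp (-‖α‖ ^ 2 / 2) : ℂ) * (α ^ k / (Real.sqrt (k.factorial : ℝ) : ℂ))

theorem memlp_coherentCoeff (α : ℂ) : Memℓp (coherentCoeff α) 2 := by
  apply memℓp_gen
  have h := (Real.summable_pow_div_factorial (‖α‖ ^ 2)).mul_left
    (Real.exp (-‖α‖ ^ 2 / 2) ^ 2)
  refine h.congr fun k => ?_
  have hk : (0 : ℝ) ≤ (k.factorial : ℝ) := by positivity
  simp only [coherentCoeff, norm_mul, norm_div, norm_pow, Complex.norm_real, Real.norm_eq_abs,
    ENNReal.toReal_ofNat, Real.rpow_two, mul_pow, div_pow, sq_abs, Real.sq_sqrt hk]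
  ring

/-- The coherent state `|α⟩ = e^{-|α|²/2} ∑ₖ α^k / √(k!) |k⟩`. -/
def coherent (α : ℂ) : FockSpace := ⟨coherentCoeff α, memlp_coherentCoeff α⟩

/-- The rank-one operator `|ψ⟩⟨ψ|`. -/
def pureState (ψ : FockSpace) : Operator := InnerProductSpace.rankOne ℂ ψ ψ

/-- The trace, computed in the Fock basis. -/
def trace (T : Operator) : ℂ := ∑' k : ℕ, inner ℂ (fock k) (T (fock k))

/-- Density operators: positive operators of finite trace, with trace one. -/
structure IsState (ρ : Operator) : Prop where
  isPositive : ρ.IsPositive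
  hasSum_trace : HasSum (fun k : ℕ => inner ℂ (fock k) (ρ (fock k))) (1 : ℂ)

/-- Discrete POVMs, indexed by `ℕ` (a finite POVM is padded with zeros): positive operators
that sum to the identity in the weak operator topology. -/
structure IsPOVM (E : ℕ → Operator) : Prop where
  isPositive : ∀ l, (E l).IsPositive
  hasSum_one : ∀ x y : FockSpace, HasSum (fun l => inner ℂ x (E l y)) (inner ℂ x y)

/-- The data of a measure-and-prepare channel: a discrete POVM, and a state to be prepared for
each outcome. -/
structure MeasurePrepare where
  effect : ℕ → Operator
  prepared : ℕ → Operator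
  isPOVM : IsPOVM effect
  isState : ∀ l, IsState (prepared l)

/-- The channel `Λ(X) = ∑ₗ Tr[X Eₗ] ρₗ`; for trace class `X` the series converges in norm. -/
def MeasurePrepare.channel (M : MeasurePrepare) (X : Operator) : Operator :=
  ∑' l : ℕ, trace (X * M.effect l) • M.prepared l

/-- The classical fidelity (classical threshold) for the ensemble of the pure states `ψ a`, with
`a` distributed according to `p`, and for the identity channel:
the supremum over all measure-and-prepare channels `Λ` of `∫ Tr[Λ(ψ_a) ψ_a] dp(a)`.
The integrand is a nonnegative real number. -/
def classicalFidelity {A : Type*} [MeasurableSpace A] (p : Measure A) (ψ : A → FockSpace) :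
    ℝ≥0∞ :=
  ⨆ M : MeasurePrepare,
    ∫⁻ a, ENNReal.ofReal (trace (M.channel (pureState (ψ a)) * pureState (ψ a))).re ∂p

/-- Invariance of a distribution on `ℂ` under all rotations `α ↦ e^{iφ} α`. -/
def PhaseInvariant (p : Measure ℂ) : Prop :=
  ∀ φ : ℝ, p.map (fun α : ℂ => Complex.exp (φ * Complex.I) * α) = p

/-- `μ_N = (1/N!) ∫ e^{-2|α|²} |α|^{2N} dp(α)`. -/
def mu (p : Measure ℂ) (N : ℕ) : ℝ :=
  1 / (N.factorial : ℝ) * ∫ α, Real.exp (-2 * ‖α‖ ^ 2) * ‖α‖ ^ (2 * N) ∂p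

/-- `ν_k = (1/k!) ∫ e^{-|α|²} |α|^{2k} dp(α)`. -/
def nu (p : Measure ℂ) (k : ℕ) : ℝ :=
  1 / (k.factorial : ℝ) * ∫ α, Real.exp (-‖α‖ ^ 2) * ‖α‖ ^ (2 * k) ∂p

/-- `sup_N μ_N ∑_{k ≤ N} binom(N,k) / q_k` in `[0,∞]`, with `1/0 = ∞` and `0 · ∞ = 0`. -/
def benchmark (p : Measure ℂ) (q : ℕ → ℝ≥0∞) : ℝ≥0∞ :=
  ⨆ N : ℕ, ENNReal.ofReal (mu p N) * ∑ k ∈ Finset.range (N + 1), (N.choose k : ℝ≥0∞) / q k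

/-- The Gaussian distribution with density `p_r(α) = (r/π) e^{-r|α|²}`. -/
def gaussian (r : ℝ) : Measure ℂ :=
  volume.withDensity fun α : ℂ => ENNReal.ofReal (r / Real.pi * Real.exp (-r * ‖α‖ ^ 2))

end CoherentTeleportation

end

/-!
The function `α ↦ e^{|α|²/2} ⟨f|α⟩` is entire, with Taylor coefficients `conj (f k) / √k!`. For rank
one `E = |f⟩⟨f|` and `ρ = |g⟩⟨g|` the integrand of the fidelity is therefore `e^{-2|α|²}` times the
squared modulus of a power series, and by Parseval's identity on circles a phase-invariant `p` keeps
only the diagonal terms: the sector of total photon number `N` contributes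
`μ_N N! |∑_{i+j=N} conj (f i) conj (g j) / √(i! j!)|²`. Cauchy–Schwarz with weights `1 / q_i` and
`q_i` bounds this by `μ_N ∑_k binom(N,k) / q_k` times `∑_{i+j=N} q_i |f i|² |g j|²`. Summed over all
sectors, effects and states, the last factors add up to `1`, since `∑ E_ℓ = 1`, `Tr ρ_ℓ = 1` and
`∑ q_k = 1`. The choice `q = ν` is allowed because `ν_k = ∫ |⟨k|α⟩|² dp(α)`.

For the Gaussian, `ν` is geometric and the binomial theorem gives every sector the same value
`(1 + r) / (2 + r)`. Heterodyne detection with outcome `β`, followed by the preparation of the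
coherent state at `β / (1 + r)`, the posterior mean of `α`, attains it; partitioning the outcomes
into countably many small cells gives discrete measurements, and Fatou's lemma passes to the limit.
-/

noncomputable section

namespace CoherentTeleportation

open Filter Topology ContinuousLinearMap
open Finset.HasAntidiagonal (antidiagonal mem_antidiagonal)

section Hilbert

variable {ι H : Type*} [NormedAddCommGroup H] [InnerProductSpace ℂ H]

/-- The quadratic form `⟨x|T|x⟩` of an operator, with values in `[0,∞]`; its negative values, which
do not occur for positive operators, are truncated to `0`. -/
def quadForm (T : H →L[ℂ] H) (x : H) : ℝ≥0∞ := ENNReal.ofReal (inner ℂ x (T x)).re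

theorem quadForm_rankOne_self (ψ x : H) :
    quadForm (InnerProductSpace.rankOne ℂ ψ ψ) x = ‖inner ℂ ψ x‖ₑ ^ 2 := by
  rw [quadForm, InnerProductSpace.rankOne_apply, inner_smul_right, ← inner_conj_symm x ψ,
    Complex.mul_conj', ← Complex.ofReal_pow, Complex.ofReal_re,
    ENNReal.ofReal_pow (norm_nonneg _), ofReal_norm]

theorem enorm_inner_le (x y : H) : ‖inner ℂ x y‖ₑ ≤ ‖x‖ₑ * ‖y‖ₑ := by
  simpa only [enorm_eq_nnnorm, ← ENNReal.coe_mul, ENNReal.coe_le_coe]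
    using nnnorm_inner_le_nnnorm (𝕜 := ℂ) x y

theorem enorm_inner_comm (x y : H) : ‖inner ℂ x y‖ₑ = ‖inner ℂ y x‖ₑ := by
  rw [← ofReal_norm, norm_inner_symm, ofReal_norm]

theorem hasSum_norm_inner_sq (b : HilbertBasis ι ℂ H) (x : H) :
    HasSum (fun i => ‖inner ℂ (b i) x‖ ^ 2) (‖x‖ ^ 2) := by
  convert Complex.hasSum_re (b.hasSum_inner_mul_inner x x) using 2 with i
  · rw [← inner_conj_symm x, Complex.conj_mul', ← Complex.ofReal_pow, Complex.ofReal_re]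
  · rw [← RCLike.re_eq_complex_re, inner_self_eq_norm_sq]

theorem tsum_enorm_inner_sq (b : HilbertBasis ι ℂ H) (x : H) :
    ∑' i, ‖inner ℂ (b i) x‖ₑ ^ 2 = ‖x‖ₑ ^ 2 := by
  have h := hasSum_norm_inner_sq b x
  simp only [← ofReal_norm, ← ENNReal.ofReal_pow (norm_nonneg _)]
  rw [← h.tsum_eq, ENNReal.ofReal_tsum_of_nonneg (fun _ => sq_nonneg _) h.summable]

theorem inner_apply_self_eq_ofReal {T : H →L[ℂ] H} (hT : T.IsPositive) (x : H) :
    inner ℂ x (T x) = ((inner ℂ x (T x)).re : ℂ) :=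
  (hT.isSymmetric.coe_re_inner_self_apply x).symm

theorem tsum_quadForm_eq_tsum_enorm_sq (b : HilbertBasis ι ℂ H) {κ : Type*} {T : H →L[ℂ] H}
    {f : κ → H} (hf : ∀ x, quadForm T x = ∑' i, ‖inner ℂ (f i) x‖ₑ ^ 2) :
    ∑' k, quadForm T (b k) = ∑' i, ‖f i‖ₑ ^ 2 := by
  simp only [hf]
  rw [ENNReal.tsum_comm]
  simp only [enorm_inner_comm (f _), tsum_enorm_inner_sq b]

theorem re_inner_apply_self_nonneg {T : H →L[ℂ] H} (hT : T.IsPositive) (x : H) :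
    0 ≤ (inner ℂ x (T x)).re :=
  hT.re_inner_nonneg_right x

variable [CompleteSpace H]

theorem quadForm_adjoint_mul_self (S : H →L[ℂ] H) (x : H) :
    quadForm (adjoint S * S) x = ‖S x‖ₑ ^ 2 := by
  rw [quadForm, mul_apply_eq_comp, adjoint_inner_right, ← RCLike.re_eq_complex_re,
    inner_self_eq_norm_sq, ENNReal.ofReal_pow (norm_nonneg _), ofReal_norm]

theorem exists_quadForm_eq_tsum (b : HilbertBasis ι ℂ H) {T : H →L[ℂ] H} (hT : T.IsPositive) :
    ∃ f : ι → H, ∀ x, quadForm T x = ∑' i, ‖inner ℂ (f i) x‖ₑ ^ 2 := by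
  obtain ⟨S, rfl⟩ := CStarAlgebra.nonneg_iff_eq_star_mul_self.1 ((nonneg_iff_isPositive T).2 hT)
  refine ⟨fun i => adjoint S (b i), fun x => ?_⟩
  simp only [star_eq_adjoint, quadForm_adjoint_mul_self, adjoint_inner_left,
    tsum_enorm_inner_sq b]

theorem quadForm_le_tsum_quadForm_mul (b : HilbertBasis ι ℂ H) {T : H →L[ℂ] H}
    (hT : T.IsPositive) (x : H) :
    quadForm T x ≤ (∑' k, quadForm T (b k)) * ‖x‖ₑ ^ 2 := by
  obtain ⟨f, hf⟩ := exists_quadForm_eq_tsum b hT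
  rw [hf, tsum_quadForm_eq_tsum_enorm_sq b hf, ← ENNReal.tsum_mul_right]
  gcongr with i
  rw [← mul_pow]
  gcongr
  exact enorm_inner_le _ _

theorem norm_le_one_of_tsum_quadForm_le_one (b : HilbertBasis ι ℂ H) {T : H →L[ℂ] H}
    (hT : T.IsPositive) (htrace : ∑' k, quadForm T (b k) ≤ 1) : ‖T‖ ≤ 1 := by
  obtain ⟨S, rfl⟩ := CStarAlgebra.nonneg_iff_eq_star_mul_self.1 ((nonneg_iff_isPositive T).2 hT)
  have hS : ‖S‖ ≤ 1 := by
    refine S.opNorm_le_bound zero_le_one fun x => ?_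
    have h := (quadForm_le_tsum_quadForm_mul b hT x).trans (mul_le_of_le_one_left' htrace)
    rw [star_eq_adjoint, quadForm_adjoint_mul_self] at h
    rw [one_mul]
    simpa only [enorm_le_iff_norm_le] using (ENNReal.pow_le_pow_left_iff two_ne_zero).1 h
  rw [CStarRing.norm_star_mul_self]
  exact mul_le_one₀ hS (norm_nonneg S) hS

end Hilbert

section Fock

/-- The Fock basis of `ℓ²(ℕ)`. -/
def fockBasis : HilbertBasis ℕ ℂ FockSpace := .ofRepr (LinearIsometryEquiv.refl ℂ FockSpace)

theorem fockBasis_apply (k : ℕ) : fockBasis k = fock k := by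
  classical rw [← fockBasis.repr_symm_single]; rfl

theorem inner_fock_left (k : ℕ) (x : FockSpace) : inner ℂ (fock k) x = x k := by
  rw [← fockBasis_apply, ← fockBasis.repr_apply_apply]; rfl

theorem tsum_enorm_coord_sq (x : FockSpace) : ∑' k, ‖x k‖ₑ ^ 2 = ‖x‖ₑ ^ 2 := by
  simpa only [fockBasis_apply, inner_fock_left] using tsum_enorm_inner_sq fockBasis x

theorem trace_rankOne (x y : FockSpace) :
    trace (InnerProductSpace.rankOne ℂ x y) = inner ℂ y x := by
  simp only [trace, InnerProductSpace.rankOne_apply, inner_smul_right, ← fockBasis_apply,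
    fockBasis.tsum_inner_mul_inner]

theorem trace_mul_pureState (T : Operator) (ψ : FockSpace) :
    trace (T * pureState ψ) = inner ℂ ψ (T ψ) := by
  rw [← trace_rankOne, pureState, mul_def, InnerProductSpace.comp_rankOne]

theorem trace_pureState_mul (T : Operator) (ψ : FockSpace) :
    trace (pureState ψ * T) = inner ℂ ψ (T ψ) := by
  rw [← adjoint_inner_left, ← trace_rankOne, pureState, mul_def, InnerProductSpace.rankOne_comp]

theorem IsState.tsum_quadForm {ρ : Operator} (hρ : IsState ρ) :
    ∑' k, quadForm ρ (fockBasis k) = 1 := by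
  have h := Complex.hasSum_re hρ.hasSum_trace
  simp only [quadForm, fockBasis_apply]
  rw [← ENNReal.ofReal_tsum_of_nonneg (fun k => re_inner_apply_self_nonneg hρ.isPositive _)
    h.summable, h.tsum_eq, Complex.one_re, ENNReal.ofReal_one]

theorem isState_pureState {ψ : FockSpace} (hψ : ‖ψ‖ = 1) : IsState (pureState ψ) where
  isPositive := InnerProductSpace.isPositive_rankOne_self ψ
  hasSum_trace := by
    have h := fockBasis.hasSum_inner_mul_inner ψ ψ
    rw [inner_self_eq_norm_sq_to_K, hψ] at h
    simpa [pureState, fockBasis_apply, inner_smul_right] using h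

theorem IsState.norm_le_one {ρ : Operator} (hρ : IsState ρ) : ‖ρ‖ ≤ 1 :=
  norm_le_one_of_tsum_quadForm_le_one fockBasis hρ.isPositive hρ.tsum_quadForm.le

theorem isPOVM_of_tsum_quadForm {E : ℕ → Operator} (hE : ∀ l, (E l).IsPositive)
    (hsum : ∀ x, ∑' l, quadForm (E l) x = ‖x‖ₑ ^ 2) : IsPOVM E where
  isPositive := hE
  hasSum_one x y := by
    have hdiag (z : FockSpace) : HasSum (fun l => inner ℂ (E l z) z) (inner ℂ z z) := by
      have hre : HasSum (fun l => (inner ℂ z (E l z)).re) (‖z‖ ^ 2) := by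
        have h := ENNReal.hasSum_toReal (f := fun l => quadForm (E l) z)
          (by rw [hsum]; finiteness)
        rw [← ENNReal.tsum_toReal_eq (f := fun l => quadForm (E l) z)
          fun _ => ENNReal.ofReal_ne_top, hsum, ENNReal.toReal_pow, toReal_enorm] at h
        simpa only [quadForm, ENNReal.toReal_ofReal (re_inner_apply_self_nonneg (hE _) z)] using h
      convert Complex.hasSum_ofReal.2 hre using 2 with l
      · rw [← inner_apply_self_eq_ofReal (hE l)]
        exact (hE l).isSymmetric z z
      · simp [inner_self_eq_norm_sq_to_K]
    have hpolar (T : Operator) := inner_map_polarization (T : FockSpace →ₗ[ℂ] FockSpace) y x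
    have hone := hpolar 1
    simp only [coe_coe, one_apply_eq_self] at hpolar hone
    simp only [← (hE _).isSymmetric.apply_clm, hpolar, hone]
    exact ((((hdiag _).sub (hdiag _)).add ((hdiag _).mul_left _)).sub
      ((hdiag _).mul_left _)).div_const _

variable (M : MeasurePrepare) (ψ : FockSpace)

theorem MeasurePrepare.hasSum_re_inner_effect :
    HasSum (fun l => (inner ℂ ψ (M.effect l ψ)).re) (‖ψ‖ ^ 2) := by
  rw [← inner_self_eq_norm_sq (𝕜 := ℂ)]
  exact Complex.hasSum_re (M.isPOVM.hasSum_one ψ ψ)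

theorem MeasurePrepare.hasSum_channel :
    HasSum (fun l => inner ℂ ψ (M.effect l ψ) • M.prepared l) (M.channel (pureState ψ)) := by
  simp only [channel, trace_pureState_mul]
  refine (Summable.of_norm_bounded (M.hasSum_re_inner_effect ψ).summable fun l => ?_).hasSum
  have hE := M.isPOVM.isPositive l
  rw [norm_smul, inner_apply_self_eq_ofReal hE, Complex.norm_real,
    Complex.ofReal_re, Real.norm_of_nonneg (re_inner_apply_self_nonneg hE ψ)]
  exact mul_le_of_le_one_right (re_inner_apply_self_nonneg hE ψ) (M.isState l).norm_le_one

theorem MeasurePrepare.ofReal_trace_channel :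
    ENNReal.ofReal (trace (M.channel (pureState ψ) * pureState ψ)).re =
      ∑' l, quadForm (M.effect l) ψ * quadForm (M.prepared l) ψ := by
  have hE (l : ℕ) : 0 ≤ (inner ℂ ψ (M.effect l ψ)).re :=
    re_inner_apply_self_nonneg (M.isPOVM.isPositive l) ψ
  have hρ (l : ℕ) : 0 ≤ (inner ℂ ψ (M.prepared l ψ)).re :=
    re_inner_apply_self_nonneg (M.isState l).isPositive ψ
  have hsum : HasSum (fun l => (inner ℂ ψ (M.effect l ψ)).re * (inner ℂ ψ (M.prepared l ψ)).re)
      (inner ℂ ψ (M.channel (pureState ψ) ψ)).re := by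
    convert Complex.hasSum_re ((M.hasSum_channel ψ).mapL
      ((innerSL ℂ ψ).comp (ContinuousLinearMap.apply ℂ FockSpace ψ))) using 2 with l
    · simp only [comp_apply, apply_apply, smul_apply, innerSL_apply_apply, inner_smul_right]
      rw [inner_apply_self_eq_ofReal (M.isPOVM.isPositive l), Complex.re_ofReal_mul,
        Complex.ofReal_re]
    · rfl
  rw [trace_mul_pureState, ← hsum.tsum_eq,
    ENNReal.ofReal_tsum_of_nonneg (fun l => mul_nonneg (hE l) (hρ l)) hsum.summable]
  exact tsum_congr fun l => ENNReal.ofReal_mul (hE l)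

end Fock

section PhaseInvariance

theorem hasSum_norm_sq_of_hasSum_smul {ι 𝕜 E : Type*} [RCLike 𝕜] [NormedAddCommGroup E]
    [InnerProductSpace 𝕜 E] {v : ι → E} (hv : Orthonormal 𝕜 v) {a : ι → 𝕜} {x : E}
    (hx : HasSum (fun i => a i • v i) x) : HasSum (fun i => ‖a i‖ ^ 2) (‖x‖ ^ 2) := by
  have hfin (s : Finset ι) : ‖∑ i ∈ s, a i • v i‖ ^ 2 = ∑ i ∈ s, ‖a i‖ ^ 2 := by
    rw [← RCLike.ofReal_inj (K := 𝕜)]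
    push_cast
    rw [← inner_self_eq_norm_sq_to_K, hv.inner_sum]
    simp only [RCLike.conj_mul]
  simpa only [HasSum, hfin] using (hx.norm.pow 2 : Tendsto _ _ _)

theorem lintegral_enorm_sq_eq_enorm_Lp_sq {X E : Type*} [MeasurableSpace X] {μ : Measure X}
    [NormedAddCommGroup E] (f : Lp E 2 μ) : ∫⁻ x, ‖f x‖ₑ ^ 2 ∂μ = ‖f‖ₑ ^ 2 := by
  simpa [Lp.enorm_def] using
    (eLpNorm_nnreal_pow_eq_lintegral (f := f) (μ := μ) (p := 2) two_ne_zero).symm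

theorem lintegral_enorm_tsum_fourier_sq {T : ℝ} [Fact (0 < T)] {ι : Type*} {e : ι → ℤ}
    (he : Function.Injective e) {a : ι → ℂ} (ha : Summable fun i => ‖a i‖) :
    ∫⁻ t : AddCircle T, ‖∑' i, a i * fourier (e i) t‖ₑ ^ 2 ∂AddCircle.haarAddCircle =
      ∑' i, ‖a i‖ₑ ^ 2 := by
  have hC : Summable fun i => a i • (fourier (e i) : C(AddCircle T, ℂ)) :=
    .of_norm_bounded ha fun i => by rw [norm_smul, fourier_norm, mul_one]
  set F := ∑' i, a i • (fourier (e i) : C(AddCircle T, ℂ))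
  set FL2 := ContinuousMap.toLp 2 AddCircle.haarAddCircle ℂ F with hFL2
  have hsum : HasSum (fun i => ‖a i‖ ^ 2) (‖FL2‖ ^ 2) := by
    have h := hC.hasSum.mapL (ContinuousMap.toLp 2 AddCircle.haarAddCircle ℂ)
    simp only [map_smul] at h
    exact hasSum_norm_sq_of_hasSum_smul (orthonormal_fourier.comp e he) h
  have hFL2_ae : ∀ᵐ t ∂AddCircle.haarAddCircle, ∑' i, a i * fourier (e i) t = FL2 t := by
    filter_upwards [ContinuousMap.coeFn_toLp (p := 2) AddCircle.haarAddCircle (𝕜 := ℂ) F]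
      with t ht
    rw [hFL2, ht, ← ContinuousMap.tsum_apply hC t]
    rfl
  calc _ = ∫⁻ t, ‖FL2 t‖ₑ ^ 2 ∂AddCircle.haarAddCircle :=
        lintegral_congr_ae (hFL2_ae.mono fun t ht => by simp only [ht])
    _ = ‖FL2‖ₑ ^ 2 := lintegral_enorm_sq_eq_enorm_Lp_sq FL2
    _ = _ := by
        simp only [← ofReal_norm, ← ENNReal.ofReal_pow (norm_nonneg _)]
        rw [← hsum.tsum_eq, ENNReal.ofReal_tsum_of_nonneg (fun _ => sq_nonneg _) hsum.summable]

variable {m : Measure ℂ}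

theorem PhaseInvariant.map_circle_mul (hm : PhaseInvariant m) (z : Circle) :
    m.map (fun α : ℂ => z * α) = m := by
  simpa only [← Circle.coe_exp, Circle.exp_arg] using hm (Complex.arg z)

theorem PhaseInvariant.lintegral_circle_mul (hm : PhaseInvariant m) (z : Circle) {G : ℂ → ℝ≥0∞}
    (hG : Measurable G) : ∫⁻ α, G (z * α) ∂m = ∫⁻ α, G α ∂m := by
  rw [← lintegral_map hG (by fun_prop), hm.map_circle_mul z]

theorem PhaseInvariant.withDensity_norm (hm : PhaseInvariant m) {w : ℝ → ℝ≥0∞}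
    (hw : Measurable w) : PhaseInvariant (m.withDensity fun α => w ‖α‖) := by
  intro φ
  have hrot : Measurable fun α : ℂ => Complex.exp (φ * Complex.I) * α := by fun_prop
  ext s hs
  rw [Measure.map_apply hrot hs, withDensity_apply _ (hrot hs), withDensity_apply _ hs]
  nth_rewrite 2 [← hm φ]
  rw [setLIntegral_map hs (by fun_prop) hrot]
  simp only [norm_mul, Complex.norm_exp_ofReal_mul_I, one_mul]

theorem measurable_of_hasSum_powerSeries {c : ℕ → ℂ} {F : ℂ → ℂ}
    (hF : ∀ α, HasSum (fun n => c n * α ^ n) (F α)) : Measurable F :=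
  measurable_of_tendsto_metrizable (f := fun N α => ∑ n ∈ Finset.range N, c n * α ^ n)
    (fun N => by fun_prop) (tendsto_pi_nhds.2 fun α => (hF α).tendsto_sum_nat)

/-- Parseval's identity on each circle centred at the origin makes distinct powers of `α`
orthogonal. -/
theorem PhaseInvariant.lintegral_enorm_powerSeries_sq [SFinite m] (hm : PhaseInvariant m)
    {c : ℕ → ℂ} {F : ℂ → ℂ} (hF : ∀ α, HasSum (fun n => c n * α ^ n) (F α)) :
    ∫⁻ α, ‖F α‖ₑ ^ 2 ∂m = ∑' n, ∫⁻ α, ‖c n * α ^ n‖ₑ ^ 2 ∂m := by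
  have : Fact (0 < 2 * Real.pi) := ⟨Real.two_pi_pos⟩
  have hFmeas := measurable_of_hasSum_powerSeries hF
  have hcircle (t : AddCircle (2 * Real.pi)) (α : ℂ) :
      F (t.toCircle * α) = ∑' n : ℕ, c n * α ^ n * fourier (n : ℤ) t := by
    rw [← (hF _).tsum_eq]
    refine tsum_congr fun n => ?_
    rw [fourier_apply, natCast_zsmul, AddCircle.toCircle_nsmul, Circle.coe_pow, mul_pow]
    ring
  calc ∫⁻ α, ‖F α‖ₑ ^ 2 ∂m
      = ∫⁻ t : AddCircle (2 * Real.pi), ∫⁻ α, ‖F (t.toCircle * α)‖ₑ ^ 2 ∂m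
          ∂AddCircle.haarAddCircle := by
        simp only [hm.lintegral_circle_mul _ (hFmeas.enorm.pow_const 2), lintegral_const,
          measure_univ, mul_one]
    _ = ∫⁻ α, ∫⁻ t : AddCircle (2 * Real.pi), ‖F (t.toCircle * α)‖ₑ ^ 2
          ∂AddCircle.haarAddCircle ∂m := by
        have : Measurable fun t : AddCircle (2 * Real.pi) => (t.toCircle : ℂ) :=
          (continuous_subtype_val.comp AddCircle.continuous_toCircle).measurable
        exact lintegral_lintegral_swap (by fun_prop)
    _ = ∫⁻ α, ∑' n, ‖c n * α ^ n‖ₑ ^ 2 ∂m := by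
        simp only [hcircle]
        exact lintegral_congr fun α =>
          lintegral_enorm_tsum_fourier_sq Nat.cast_injective (hF α).summable.norm
    _ = ∑' n, ∫⁻ α, ‖c n * α ^ n‖ₑ ^ 2 ∂m := lintegral_tsum fun n => by fun_prop

theorem PhaseInvariant.lintegral_mul_enorm_powerSeries_sq [SFinite m] (hm : PhaseInvariant m)
    {c : ℕ → ℂ} {F : ℂ → ℂ} (hF : ∀ α, HasSum (fun n => c n * α ^ n) (F α)) {w : ℝ → ℝ≥0∞}
    (hw : Measurable w) :
    ∫⁻ α, w ‖α‖ * ‖F α‖ₑ ^ 2 ∂m = ∑' n, ‖c n‖ₑ ^ 2 * ∫⁻ α, w ‖α‖ * ‖α‖ₑ ^ (2 * n) ∂m := by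
  have hFmeas := measurable_of_hasSum_powerSeries hF
  have hw' : Measurable fun α : ℂ => w ‖α‖ := by fun_prop
  have h := (hm.withDensity_norm hw).lintegral_enorm_powerSeries_sq hF
  rw [lintegral_withDensity_eq_lintegral_mul _ hw' (by fun_prop)] at h
  refine h.trans (tsum_congr fun n => ?_)
  rw [lintegral_withDensity_eq_lintegral_mul _ hw' (by fun_prop), ← lintegral_const_mul _
    (by fun_prop)]
  refine lintegral_congr fun α => ?_
  simp only [Pi.mul_apply, enorm_mul, enorm_pow, mul_pow, ← pow_mul, mul_comm n 2]
  ring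

theorem phaseInvariant_volume : PhaseInvariant (volume : Measure ℂ) := fun φ =>
  (rotation (Circle.exp φ)).measurePreserving.map_eq

theorem phaseInvariant_gaussian (r : ℝ) : PhaseInvariant (gaussian r) :=
  phaseInvariant_volume.withDensity_norm
    (w := fun t => ENNReal.ofReal (r / Real.pi * Real.exp (-r * t ^ 2))) (by fun_prop)

end PhaseInvariance

section Coherent

theorem coherent_apply (α : ℂ) (k : ℕ) : coherent α k =
    (Real.exp (-‖α‖ ^ 2 / 2) : ℂ) * (α ^ k / (Real.sqrt (k.factorial : ℝ) : ℂ)) := rfl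

/-- The Bargmann function `α ↦ e^{|α|²/2} ⟨f|α⟩` of a vector: removing the Gaussian factor from the
overlaps with coherent states leaves an entire function of `α`. -/
def bargmann (f : FockSpace) (α : ℂ) : ℂ := Real.exp (‖α‖ ^ 2 / 2) * inner ℂ f (coherent α)

/-- The Taylor coefficients of the entire function `bargmann f`. -/
def bargmannCoeff (f : FockSpace) (k : ℕ) : ℂ :=
  (starRingEnd ℂ) (f k) / (Real.sqrt (k.factorial : ℝ) : ℂ)

theorem enorm_bargmannCoeff_sq (f : FockSpace) (k : ℕ) :
    ‖bargmannCoeff f k‖ₑ ^ 2 = ‖f k‖ₑ ^ 2 / k.factorial := by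
  rw [bargmannCoeff, ← ofReal_norm, ← ENNReal.ofReal_pow (norm_nonneg _), norm_div, div_pow,
    RCLike.norm_conj, Complex.norm_real, Real.norm_eq_abs, sq_abs, Real.sq_sqrt (by positivity),
    ENNReal.ofReal_div_of_pos (by positivity), ENNReal.ofReal_natCast,
    ENNReal.ofReal_pow (norm_nonneg _), ofReal_norm]

theorem hasSum_bargmann (f : FockSpace) (α : ℂ) :
    HasSum (fun k => bargmannCoeff f k * α ^ k) (bargmann f α) := by
  have hexp : (Real.exp (‖α‖ ^ 2 / 2) : ℂ) * Real.exp (-‖α‖ ^ 2 / 2) = 1 := by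
    rw [← Complex.ofReal_mul, ← Real.exp_add]
    simp [neg_div]
  refine ((lp.hasSum_inner (𝕜 := ℂ) f (coherent α)).mul_left
    (Real.exp (‖α‖ ^ 2 / 2) : ℂ)).congr_fun fun k => ?_
  rw [RCLike.inner_apply', coherent_apply, bargmannCoeff]
  linear_combination -(starRingEnd ℂ) (f k) * α ^ k / (Real.sqrt (k.factorial : ℝ) : ℂ) * hexp

theorem inner_coherent_eq_bargmann (f : FockSpace) (α : ℂ) :
    inner ℂ f (coherent α) = Real.exp (-‖α‖ ^ 2 / 2) * bargmann f α := by
  rw [bargmann, ← mul_assoc, ← Complex.ofReal_mul, ← Real.exp_add]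
  simp [neg_div]

theorem enorm_inner_coherent_right_sq (f : FockSpace) (α : ℂ) :
    ‖inner ℂ f (coherent α)‖ₑ ^ 2 =
      ENNReal.ofReal (Real.exp (-‖α‖ ^ 2)) * ‖bargmann f α‖ₑ ^ 2 := by
  rw [inner_coherent_eq_bargmann, enorm_mul, mul_pow, ← ofReal_norm (Complex.ofReal _),
    Complex.norm_real, Real.norm_of_nonneg (Real.exp_nonneg _),
    ← ENNReal.ofReal_pow (Real.exp_nonneg _), ← Real.exp_nat_mul]
  congr 4
  ring

theorem bargmann_coherent (α β : ℂ) :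
    bargmann (coherent α) β =
      Real.exp (-‖α‖ ^ 2 / 2) * Complex.exp ((starRingEnd ℂ) α * β) := by
  have h := (NormedSpace.expSeries_div_hasSum_exp ((starRingEnd ℂ) α * β)).mul_left
    (Real.exp (-‖α‖ ^ 2 / 2) : ℂ)
  rw [← Complex.exp_eq_exp_ℂ] at h
  refine (hasSum_bargmann _ β).unique (h.congr_fun fun k => ?_)
  have hk : (Real.sqrt (k.factorial : ℝ) : ℂ) * (Real.sqrt (k.factorial : ℝ) : ℂ) =
      (k.factorial : ℂ) := by
    rw [← Complex.ofReal_mul, Real.mul_self_sqrt (by positivity), Complex.ofReal_natCast]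
  rw [bargmannCoeff, coherent_apply, ← hk, map_mul, map_div₀, Complex.conj_ofReal,
    Complex.conj_ofReal, map_pow, mul_pow]
  field_simp

theorem enorm_inner_coherent_sq (α β : ℂ) :
    ‖inner ℂ (coherent α) (coherent β)‖ₑ ^ 2 = ENNReal.ofReal (Real.exp (-‖α - β‖ ^ 2)) := by
  rw [inner_coherent_eq_bargmann, bargmann_coherent, ← ofReal_norm,
    ← ENNReal.ofReal_pow (norm_nonneg _), norm_mul, norm_mul, Complex.norm_real, Complex.norm_real,
    Complex.norm_exp, Real.norm_of_nonneg (Real.exp_nonneg _),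
    Real.norm_of_nonneg (Real.exp_nonneg _), ← Real.exp_add, ← Real.exp_add, ← Real.exp_nat_mul,
    ← RCLike.re_eq_complex_re, ← RCLike.inner_apply', norm_sub_sq (𝕜 := ℂ)]
  congr 2
  push_cast
  ring

theorem norm_coherent (α : ℂ) : ‖coherent α‖ = 1 := by
  have h := enorm_inner_coherent_sq α α
  rw [inner_self_eq_norm_sq_to_K, ← ofReal_norm, norm_pow, RCLike.norm_ofReal, abs_norm,
    ← ENNReal.ofReal_pow (by positivity), ← pow_mul] at h
  rwa [sub_self, norm_zero, zero_pow two_ne_zero, neg_zero, Real.exp_zero, ENNReal.ofReal_one,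
    ENNReal.ofReal_eq_one, pow_eq_one_iff_of_nonneg (norm_nonneg _) (by norm_num)] at h

theorem continuous_coherent : Continuous coherent := by
  rw [continuous_iff_continuousAt]
  intro β
  rw [ContinuousAt, tendsto_iff_norm_sub_tendsto_zero]
  have hdist (α : ℂ) : ‖coherent α - coherent β‖ =
      Real.sqrt (2 - 2 * (Real.exp (-‖α‖ ^ 2 / 2) * bargmann (coherent β) α).re) := by
    rw [← inner_coherent_eq_bargmann, ← Real.sqrt_sq (norm_nonneg (coherent α - coherent β)),
      norm_sub_rev, norm_sub_sq (𝕜 := ℂ), norm_coherent, norm_coherent, RCLike.re_eq_complex_re]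
    ring_nf
  have hcont : Continuous fun α => ‖coherent α - coherent β‖ := by
    simp only [hdist, bargmann_coherent]
    fun_prop
  simpa using hcont.tendsto β

theorem continuous_pureState_coherent : Continuous fun β => pureState (coherent β) := by
  simp only [pureState, InnerProductSpace.rankOne_def']
  exact ((ContinuousLinearMap.toSpanSingletonLIE ℂ FockSpace).continuous.comp
    continuous_coherent).clm_comp ((innerSL ℂ).continuous.comp continuous_coherent)

end Coherent

section Moments

/-- The moment `∫ e^{-b|α|²} |α|^{2n} dp(α)` as an element of `[0,∞]`, where it needs no
integrability; `μ_N` and `ν_k` are such moments with `b = 2` and `b = 1`, up to factorials. -/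
def dampedMoment (b : ℝ) (p : Measure ℂ) (n : ℕ) : ℝ≥0∞ :=
  ∫⁻ α, ENNReal.ofReal (Real.exp (-b * ‖α‖ ^ 2)) * ‖α‖ₑ ^ (2 * n) ∂p

variable {b : ℝ}

theorem dampedMoment_eq_lintegral_ofReal (b : ℝ) (p : Measure ℂ) (n : ℕ) :
    dampedMoment b p n =
      ∫⁻ α, ENNReal.ofReal (Real.exp (-b * ‖α‖ ^ 2) * ‖α‖ ^ (2 * n)) ∂p :=
  lintegral_congr fun α => by
    rw [ENNReal.ofReal_mul (Real.exp_nonneg _), ENNReal.ofReal_pow (norm_nonneg _), ofReal_norm]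

theorem exp_neg_mul_mul_pow_le (hb : 0 < b) {x : ℝ} (hx : 0 ≤ x) (n : ℕ) :
    Real.exp (-b * x) * x ^ n ≤ n.factorial / b ^ n := by
  have h := Real.pow_div_factorial_le_exp (b * x) (by positivity) n
  rw [div_le_iff₀ (by positivity), mul_pow] at h
  rw [neg_mul, Real.exp_neg, inv_mul_le_iff₀ (Real.exp_pos _), ← mul_div_assoc,
    le_div_iff₀ (by positivity)]
  linarith

theorem integrable_exp_neg_mul_norm_pow (p : Measure ℂ) [IsFiniteMeasure p] (hb : 0 < b) (n : ℕ) :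
    Integrable (fun α : ℂ => Real.exp (-b * ‖α‖ ^ 2) * ‖α‖ ^ (2 * n)) p := by
  refine .of_bound (C := n.factorial / b ^ n) (by fun_prop) (ae_of_all _ fun α => ?_)
  rw [Real.norm_of_nonneg (by positivity), pow_mul]
  exact exp_neg_mul_mul_pow_le hb (sq_nonneg _) n

theorem ofReal_inv_factorial_mul_integral (p : Measure ℂ) [IsFiniteMeasure p] (hb : 0 < b)
    (n : ℕ) :
    ENNReal.ofReal (1 / (n.factorial : ℝ) * ∫ α, Real.exp (-b * ‖α‖ ^ 2) * ‖α‖ ^ (2 * n) ∂p) =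
      dampedMoment b p n / n.factorial := by
  rw [one_div_mul_eq_div, ENNReal.ofReal_div_of_pos (by positivity), ENNReal.ofReal_natCast,
    dampedMoment_eq_lintegral_ofReal, ofReal_integral_eq_lintegral_ofReal
      (integrable_exp_neg_mul_norm_pow p hb n) (ae_of_all _ fun _ => by positivity)]

theorem ofReal_mu (p : Measure ℂ) [IsFiniteMeasure p] (N : ℕ) :
    ENNReal.ofReal (mu p N) = dampedMoment 2 p N / N.factorial :=
  ofReal_inv_factorial_mul_integral p two_pos N

theorem ofReal_nu (p : Measure ℂ) [IsFiniteMeasure p] (k : ℕ) :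
    ENNReal.ofReal (nu p k) = dampedMoment 1 p k / k.factorial := by
  rw [← ofReal_inv_factorial_mul_integral p one_pos, nu]
  simp only [neg_one_mul]

theorem enorm_coherent_apply_sq (α : ℂ) (k : ℕ) :
    ‖coherent α k‖ₑ ^ 2 =
      ENNReal.ofReal (Real.exp (-1 * ‖α‖ ^ 2)) * ‖α‖ₑ ^ (2 * k) / k.factorial := by
  rw [coherent_apply, enorm_mul, mul_pow, ← ofReal_norm, Complex.norm_real,
    Real.norm_of_nonneg (Real.exp_nonneg _), ← ENNReal.ofReal_pow (Real.exp_nonneg _),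
    ← Real.exp_nat_mul, mul_div_assoc, ← ofReal_norm, ← ENNReal.ofReal_pow (norm_nonneg _),
    norm_div, norm_pow, Complex.norm_real, div_pow, Real.norm_eq_abs, sq_abs,
    Real.sq_sqrt (by positivity), ENNReal.ofReal_div_of_pos (by positivity),
    ENNReal.ofReal_natCast, ← pow_mul, ENNReal.ofReal_pow (norm_nonneg _), ofReal_norm, mul_comm k]
  congr 3
  push_cast
  ring

theorem tsum_ofReal_nu (p : Measure ℂ) [IsProbabilityMeasure p] :
    ∑' k, ENNReal.ofReal (nu p k) = 1 := by
  have hk (k : ℕ) : ENNReal.ofReal (nu p k) = ∫⁻ α, ‖coherent α k‖ₑ ^ 2 ∂p := by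
    simp only [ofReal_nu, dampedMoment, enorm_coherent_apply_sq, div_eq_mul_inv]
    rw [lintegral_mul_const _ (by fun_prop)]
  have hmeas (k : ℕ) : AEMeasurable (fun α => ‖coherent α k‖ₑ ^ 2) p := by
    simp only [enorm_coherent_apply_sq]
    fun_prop
  simp only [hk]
  rw [← lintegral_tsum hmeas]
  simp only [tsum_enorm_coord_sq]
  simp only [← ofReal_norm, norm_coherent, ENNReal.ofReal_one, one_pow, lintegral_const,
    measure_univ, mul_one]

theorem iInf_benchmark_le (p : Measure ℂ) [IsProbabilityMeasure p] :
    (⨅ q : PMF ℕ, benchmark p (fun k => q k)) ≤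
      benchmark p (fun k => ENNReal.ofReal (nu p k)) :=
  iInf_le (fun q : PMF ℕ => benchmark p (fun k => q k))
    ⟨fun k => ENNReal.ofReal (nu p k), tsum_ofReal_nu p ▸ ENNReal.summable.hasSum⟩

theorem integral_exp_neg_mul_norm_pow (hb : 0 < b) (n : ℕ) :
    ∫ α : ℂ, Real.exp (-b * ‖α‖ ^ 2) * ‖α‖ ^ (2 * n) = Real.pi * n.factorial / b ^ (n + 1) := by
  have h := Complex.integral_rpow_mul_exp_neg_mul_rpow (p := 2) (q := (2 * n : ℕ)) (b := b)
    one_le_two (neg_one_lt_zero.trans_le (Nat.cast_nonneg _) |>.trans_le' (by norm_num)) hb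
  have hGamma : ((2 * n : ℕ) + 2 : ℝ) / 2 = n + 1 := by push_cast; ring
  have hpow : -((2 * n : ℕ) + 2 : ℝ) / 2 = -((n + 1 : ℕ) : ℝ) := by push_cast; ring
  rw [hGamma, hpow, Real.Gamma_nat_eq_factorial, Real.rpow_neg hb.le] at h
  simp only [Real.rpow_natCast, Real.rpow_two] at h
  simp only [mul_comm (Real.exp _), h]
  field_simp

theorem dampedMoment_volume (hb : 0 < b) (n : ℕ) :
    dampedMoment b volume n = ENNReal.ofReal (Real.pi * n.factorial / b ^ (n + 1)) := by
  have h := integral_exp_neg_mul_norm_pow hb n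
  rw [dampedMoment_eq_lintegral_ofReal, ← h, ofReal_integral_eq_lintegral_ofReal _
    (ae_of_all _ fun _ => by positivity)]
  exact .of_integral_ne_zero (h ▸ by positivity)

theorem dampedMoment_gaussian {r : ℝ} (hr : 0 < r) (hb : 0 ≤ b) (n : ℕ) :
    dampedMoment b (gaussian r) n = ENNReal.ofReal (r * n.factorial / (b + r) ^ (n + 1)) := by
  have hpi : r * n.factorial / (b + r) ^ (n + 1) =
      r / Real.pi * (Real.pi * n.factorial / (b + r) ^ (n + 1)) := by field_simp
  rw [hpi, ENNReal.ofReal_mul (by positivity), ← dampedMoment_volume (by positivity), dampedMoment,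
    dampedMoment, gaussian, lintegral_withDensity_eq_lintegral_mul _ (by fun_prop) (by fun_prop),
    ← lintegral_const_mul _ (by fun_prop)]
  refine lintegral_congr fun α => ?_
  rw [Pi.mul_apply, ENNReal.ofReal_mul (by positivity), mul_assoc, ← mul_assoc (ENNReal.ofReal
    (Real.exp _)), ← ENNReal.ofReal_mul (Real.exp_nonneg _), ← Real.exp_add]
  ring_nf

theorem isProbabilityMeasure_gaussian {r : ℝ} (hr : 0 < r) :
    IsProbabilityMeasure (gaussian r) := by
  have h := dampedMoment_gaussian hr le_rfl 0
  constructor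
  simpa [dampedMoment, hr.ne'] using h

theorem ofReal_mu_gaussian {r : ℝ} (hr : 0 < r) (N : ℕ) :
    ENNReal.ofReal (mu (gaussian r) N) = ENNReal.ofReal (r / (2 + r) ^ (N + 1)) := by
  have := isProbabilityMeasure_gaussian hr
  rw [ofReal_mu, dampedMoment_gaussian hr zero_le_two, ← ENNReal.ofReal_natCast,
    ← ENNReal.ofReal_div_of_pos (by positivity)]
  congr 1
  field_simp

theorem ofReal_nu_gaussian {r : ℝ} (hr : 0 < r) (k : ℕ) :
    ENNReal.ofReal (nu (gaussian r) k) = ENNReal.ofReal (r / (1 + r) ^ (k + 1)) := by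
  have := isProbabilityMeasure_gaussian hr
  rw [ofReal_nu, dampedMoment_gaussian hr zero_le_one, ← ENNReal.ofReal_natCast,
    ← ENNReal.ofReal_div_of_pos (by positivity)]
  congr 1
  field_simp

theorem benchmark_gaussian {r : ℝ} (hr : 0 < r) :
    benchmark (gaussian r) (fun k => ENNReal.ofReal (nu (gaussian r) k)) =
      ENNReal.ofReal ((1 + r) / (2 + r)) := by
  have hratio (N k : ℕ) : (N.choose k : ℝ≥0∞) / ENNReal.ofReal (nu (gaussian r) k) =
      ENNReal.ofReal ((1 + r) / r * ((1 + r) ^ k * N.choose k)) := by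
    rw [ofReal_nu_gaussian hr, ← ENNReal.ofReal_natCast,
      ← ENNReal.ofReal_div_of_pos (by positivity)]
    congr 1
    field_simp
    ring
  have hbinom (N : ℕ) : ∑ k ∈ Finset.range (N + 1), (1 + r) ^ k * (N.choose k : ℝ) =
      (2 + r) ^ N := by
    have h := add_pow (1 + r) 1 N
    simp only [one_pow, mul_one] at h
    rw [← h]
    ring
  have hsector (N : ℕ) : ENNReal.ofReal (mu (gaussian r) N) * ∑ k ∈ Finset.range (N + 1),
      (N.choose k : ℝ≥0∞) / ENNReal.ofReal (nu (gaussian r) k) =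
        ENNReal.ofReal ((1 + r) / (2 + r)) := by
    simp only [hratio]
    rw [← ENNReal.ofReal_sum_of_nonneg fun k _ => by positivity, ← Finset.mul_sum, hbinom,
      ofReal_mu_gaussian hr, ← ENNReal.ofReal_mul (by positivity)]
    congr 1
    field_simp
    ring
  simp only [benchmark, hsector, ciSup_const]

end Moments

section UpperBound

theorem sq_sum_le_sum_mul_sum {ι : Type*} {s : Finset ι} {x u v : ι → ℝ≥0∞}
    (h : ∀ i ∈ s, x i ^ 2 ≤ u i * v i) : (∑ i ∈ s, x i) ^ 2 ≤ (∑ i ∈ s, u i) * ∑ i ∈ s, v i := by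
  have hsqrt (a : ℝ≥0∞) : (a ^ (1 / 2 : ℝ)) ^ (2 : ℝ) = a := by
    rw [← ENNReal.rpow_mul, one_div_mul_cancel two_ne_zero, ENNReal.rpow_one]
  have hterm : ∀ i ∈ s, x i ≤ u i ^ (1 / 2 : ℝ) * v i ^ (1 / 2 : ℝ) := fun i hi => by
    rw [← ENNReal.mul_rpow_of_nonneg _ _ (by positivity), one_div,
      ENNReal.le_rpow_inv_iff two_pos, ENNReal.rpow_two]
    exact h i hi
  have hHolder := (Finset.sum_le_sum hterm).trans
    (ENNReal.inner_le_Lp_mul_Lq s _ _ Real.HolderConjugate.two_two)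
  simp only [hsqrt] at hHolder
  calc (∑ i ∈ s, x i) ^ 2
      ≤ ((∑ i ∈ s, u i) ^ (1 / 2 : ℝ) * (∑ i ∈ s, v i) ^ (1 / 2 : ℝ)) ^ 2 := by gcongr
    _ = _ := by rw [mul_pow, ← ENNReal.rpow_two, ← ENNReal.rpow_two, hsqrt, hsqrt]

theorem tsum_sum_antidiagonal_mul (u v : ℕ → ℝ≥0∞) :
    ∑' N, ∑ ij ∈ antidiagonal N, u ij.1 * v ij.2 = (∑' k, u k) * ∑' l, v l := by
  rw [← ENNReal.tsum_mul_right]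
  simp only [← ENNReal.tsum_mul_left]
  rw [← ENNReal.tsum_prod, ← Finset.HasAntidiagonal.sigmaAntidiagonalEquivProd.tsum_eq,
    ENNReal.tsum_sigma']
  exact tsum_congr fun N => (Finset.tsum_subtype _ fun ij : ℕ × ℕ => u ij.1 * v ij.2).symm

theorem choose_div_factorial {N i j : ℕ} (h : i + j = N) :
    (N.choose i : ℝ≥0∞) / N.factorial = 1 / (i.factorial * j.factorial) := by
  subst h
  have hne (n : ℕ) : (n.factorial : ℝ≥0∞) ≠ 0 := Nat.cast_ne_zero.2 n.factorial_ne_zero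
  rw [ENNReal.div_eq_div_iff (mul_ne_zero (hne i) (hne j)) (by finiteness) (hne _)
    (by finiteness), mul_one, ← Nat.add_choose_mul_factorial_mul_factorial i j, Nat.choose_symm_add]
  push_cast
  ring

/-- The Taylor coefficients of the product `bargmann f * bargmann g`. -/
def bargmannMulCoeff (f g : FockSpace) (N : ℕ) : ℂ :=
  ∑ ij ∈ antidiagonal N, bargmannCoeff f ij.1 * bargmannCoeff g ij.2

theorem hasSum_bargmann_mul (f g : FockSpace) (α : ℂ) :
    HasSum (fun N => bargmannMulCoeff f g N * α ^ N) (bargmann f α * bargmann g α) := by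
  have hf := hasSum_bargmann f α
  have hg := hasSum_bargmann g α
  rw [← hf.tsum_eq, ← hg.tsum_eq,
    tsum_mul_tsum_eq_tsum_sum_antidiagonal_of_summable_norm hf.summable.norm hg.summable.norm]
  refine (summable_norm_sum_mul_antidiagonal_of_summable_norm hf.summable.norm
    hg.summable.norm).of_norm.hasSum.congr_fun fun N => ?_
  rw [bargmannMulCoeff, Finset.sum_mul]
  refine Finset.sum_congr rfl fun ij hij => ?_
  rw [← mem_antidiagonal.1 hij, pow_add]
  ring

theorem factorial_mul_enorm_bargmannMulCoeff_sq_le {q : ℕ → ℝ≥0∞} {N : ℕ}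
    (hq0 : ∀ k ≤ N, q k ≠ 0) (hq : ∀ k ≤ N, q k ≠ ∞) (f g : FockSpace) :
    N.factorial * ‖bargmannMulCoeff f g N‖ₑ ^ 2 ≤
      (∑ k ∈ Finset.range (N + 1), (N.choose k : ℝ≥0∞) / q k) *
        ∑ ij ∈ antidiagonal N, q ij.1 * ‖f ij.1‖ₑ ^ 2 * ‖g ij.2‖ₑ ^ 2 := by
  have hterm : ∀ ij ∈ antidiagonal N, ‖bargmannCoeff f ij.1 * bargmannCoeff g ij.2‖ₑ ^ 2 ≤
      ((N.choose ij.1 : ℝ≥0∞) / q ij.1 / N.factorial) *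
        (q ij.1 * ‖f ij.1‖ₑ ^ 2 * ‖g ij.2‖ₑ ^ 2) := fun ij hij => by
    have hcancel := ENNReal.inv_mul_cancel (hq0 _ (antidiagonal.fst_le hij))
      (hq _ (antidiagonal.fst_le hij))
    calc ‖bargmannCoeff f ij.1 * bargmannCoeff g ij.2‖ₑ ^ 2
        = ‖f ij.1‖ₑ ^ 2 * ‖g ij.2‖ₑ ^ 2 * (1 / (ij.1.factorial * ij.2.factorial)) := by
          rw [enorm_mul, mul_pow, enorm_bargmannCoeff_sq, enorm_bargmannCoeff_sq, one_div,
            ENNReal.mul_inv (by simp) (by simp)]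
          simp only [div_eq_mul_inv]
          ring
      _ = ((q ij.1)⁻¹ * q ij.1) * (‖f ij.1‖ₑ ^ 2 * ‖g ij.2‖ₑ ^ 2 *
            ((N.choose ij.1 : ℝ≥0∞) / N.factorial)) := by
          rw [hcancel, one_mul, choose_div_factorial (mem_antidiagonal.1 hij)]
      _ ≤ _ := le_of_eq (by simp only [div_eq_mul_inv]; ring)
  have hN : (N.factorial : ℝ≥0∞) ≠ 0 := Nat.cast_ne_zero.2 N.factorial_ne_zero
  calc N.factorial * ‖bargmannMulCoeff f g N‖ₑ ^ 2
      ≤ N.factorial * ((∑ ij ∈ antidiagonal N, (N.choose ij.1 : ℝ≥0∞) / q ij.1 /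
          N.factorial) *
            ∑ ij ∈ antidiagonal N, q ij.1 * ‖f ij.1‖ₑ ^ 2 * ‖g ij.2‖ₑ ^ 2) := by
        gcongr
        exact (pow_le_pow_left' (enorm_sum_le _ _) 2).trans (sq_sum_le_sum_mul_sum hterm)
    _ = _ := by
        rw [← Finset.Nat.sum_antidiagonal_eq_sum_range_succ_mk
          (fun ij : ℕ × ℕ => (N.choose ij.1 : ℝ≥0∞) / q ij.1), ← mul_assoc]
        congr 1
        rw [Finset.mul_sum]
        exact Finset.sum_congr rfl fun _ _ => ENNReal.mul_div_cancel hN (ENNReal.natCast_ne_top _)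

variable {p : Measure ℂ}

theorem ne_zero_of_benchmark_ne_top {q : ℕ → ℝ≥0∞} (hB : benchmark p q ≠ ∞) {N : ℕ}
    (hN : ENNReal.ofReal (mu p N) ≠ 0) {k : ℕ} (hk : k ≤ N) : q k ≠ 0 := by
  intro h0
  have htop : ∑ k ∈ Finset.range (N + 1), (N.choose k : ℝ≥0∞) / q k = ∞ :=
    ENNReal.sum_eq_top.2 ⟨k, Finset.mem_range_succ_iff.2 hk, by
      rw [h0, ENNReal.div_zero (Nat.cast_ne_zero.2 (Nat.choose_pos hk).ne')]⟩
  refine hB (top_le_iff.1 ?_)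
  calc ∞ = ENNReal.ofReal (mu p N) * ∞ := (ENNReal.mul_top hN).symm
    _ ≤ benchmark p q := htop ▸ le_iSup (fun N => ENNReal.ofReal (mu p N) * ∑ k ∈
        Finset.range (N + 1), (N.choose k : ℝ≥0∞) / q k) N

variable [IsFiniteMeasure p]

theorem PhaseInvariant.lintegral_enorm_inner_coherent_sq_mul (hp : PhaseInvariant p)
    (f g : FockSpace) :
    ∫⁻ α, ‖inner ℂ f (coherent α)‖ₑ ^ 2 * ‖inner ℂ g (coherent α)‖ₑ ^ 2 ∂p =
      ∑' N, ENNReal.ofReal (mu p N) * (N.factorial * ‖bargmannMulCoeff f g N‖ₑ ^ 2) := by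
  have hpoint (α : ℂ) : ‖inner ℂ f (coherent α)‖ₑ ^ 2 * ‖inner ℂ g (coherent α)‖ₑ ^ 2 =
      ENNReal.ofReal (Real.exp (-2 * ‖α‖ ^ 2)) * ‖bargmann f α * bargmann g α‖ₑ ^ 2 := by
    rw [enorm_inner_coherent_right_sq, enorm_inner_coherent_right_sq, mul_mul_mul_comm,
      ← ENNReal.ofReal_mul (Real.exp_nonneg _), ← Real.exp_add, enorm_mul, mul_pow]
    ring_nf
  simp only [hpoint]
  rw [hp.lintegral_mul_enorm_powerSeries_sq (hasSum_bargmann_mul f g)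
    (w := fun t => ENNReal.ofReal (Real.exp (-2 * t ^ 2))) (by fun_prop)]
  refine tsum_congr fun N => ?_
  rw [ofReal_mu, ← mul_assoc, ENNReal.div_mul_cancel (Nat.cast_ne_zero.2 N.factorial_ne_zero)
    (ENNReal.natCast_ne_top _), mul_comm, dampedMoment]

theorem PhaseInvariant.lintegral_enorm_inner_coherent_sq_mul_le (hp : PhaseInvariant p)
    {q : ℕ → ℝ≥0∞} (hq : ∀ k, q k ≠ ∞) (hB : benchmark p q ≠ ∞) (f g : FockSpace) :
    ∫⁻ α, ‖inner ℂ f (coherent α)‖ₑ ^ 2 * ‖inner ℂ g (coherent α)‖ₑ ^ 2 ∂p ≤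
      benchmark p q * ((∑' k, q k * ‖f k‖ₑ ^ 2) * ‖g‖ₑ ^ 2) := by
  rw [hp.lintegral_enorm_inner_coherent_sq_mul, ← tsum_enorm_coord_sq g,
    ← tsum_sum_antidiagonal_mul, ← ENNReal.tsum_mul_left]
  refine ENNReal.tsum_le_tsum fun N => ?_
  rcases eq_or_ne (ENNReal.ofReal (mu p N)) 0 with hN | hN
  · rw [hN, zero_mul]
    exact zero_le
  grw [factorial_mul_enorm_bargmannMulCoeff_sq_le
    (fun k hk => ne_zero_of_benchmark_ne_top hB hN hk) (fun k _ => hq k), ← mul_assoc]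
  gcongr
  exact le_iSup (fun N => ENNReal.ofReal (mu p N) * ∑ k ∈
    Finset.range (N + 1), (N.choose k : ℝ≥0∞) / q k) N

theorem measurable_quadForm_coherent (T : Operator) :
    Measurable fun α => quadForm T (coherent α) :=
  (Complex.measurable_re.comp (continuous_coherent.inner
    (T.continuous.comp continuous_coherent)).measurable).ennreal_ofReal

theorem PhaseInvariant.lintegral_quadForm_mul_le (hp : PhaseInvariant p) {q : ℕ → ℝ≥0∞}
    (hq : ∀ k, q k ≠ ∞) (hB : benchmark p q ≠ ∞) {E ρ : Operator} (hE : E.IsPositive)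
    (hρ : IsState ρ) :
    ∫⁻ α, quadForm E (coherent α) * quadForm ρ (coherent α) ∂p ≤
      benchmark p q * ∑' k, q k * quadForm E (fock k) := by
  obtain ⟨f, hf⟩ := exists_quadForm_eq_tsum fockBasis hE
  obtain ⟨g, hg⟩ := exists_quadForm_eq_tsum fockBasis hρ.isPositive
  have htrace : ∑' j, ‖g j‖ₑ ^ 2 = 1 :=
    (tsum_quadForm_eq_tsum_enorm_sq fockBasis hg).symm.trans hρ.tsum_quadForm
  have := continuous_coherent
  calc ∫⁻ α, quadForm E (coherent α) * quadForm ρ (coherent α) ∂p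
      = ∑' i, ∑' j, ∫⁻ α, ‖inner ℂ (f i) (coherent α)‖ₑ ^ 2 *
          ‖inner ℂ (g j) (coherent α)‖ₑ ^ 2 ∂p := by
        simp only [hf, hg, ← ENNReal.tsum_mul_right]
        rw [lintegral_tsum fun i => by fun_prop]
        simp only [← ENNReal.tsum_mul_left]
        exact tsum_congr fun i => lintegral_tsum fun j => by fun_prop
    _ ≤ ∑' i, ∑' j, benchmark p q * ((∑' k, q k * ‖f i k‖ₑ ^ 2) * ‖g j‖ₑ ^ 2) := by
        gcongr with i j
        exact hp.lintegral_enorm_inner_coherent_sq_mul_le hq hB _ _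
    _ = benchmark p q * ∑' i, ∑' k, q k * ‖f i k‖ₑ ^ 2 := by
        simp only [ENNReal.tsum_mul_left, htrace, mul_one]
    _ = benchmark p q * ∑' k, q k * quadForm E (fock k) := by
        rw [ENNReal.tsum_comm]
        simp only [ENNReal.tsum_mul_left, hf, enorm_inner_comm _ (fock _), inner_fock_left]

theorem MeasurePrepare.tsum_quadForm_effect (M : MeasurePrepare) (ψ : FockSpace) :
    ∑' l, quadForm (M.effect l) ψ = ‖ψ‖ₑ ^ 2 := by
  have h := M.hasSum_re_inner_effect ψ
  simp only [quadForm]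
  rw [← ENNReal.ofReal_tsum_of_nonneg (fun l => re_inner_apply_self_nonneg
    (M.isPOVM.isPositive l) ψ) h.summable, h.tsum_eq, ENNReal.ofReal_pow (norm_nonneg _),
    ofReal_norm]

theorem PhaseInvariant.classicalFidelity_coherent_le (hp : PhaseInvariant p) (q : PMF ℕ) :
    classicalFidelity p coherent ≤ benchmark p (fun k => q k) := by
  rcases eq_or_ne (benchmark p fun k => q k) ∞ with hB | hB
  · exact hB ▸ le_top
  refine iSup_le fun M => ?_
  have hfock (k : ℕ) : ‖fock k‖ₑ ^ 2 = 1 := by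
    simp [← fockBasis_apply, ← ofReal_norm, fockBasis.orthonormal.norm_eq_one]
  have hmeas := measurable_quadForm_coherent
  simp only [M.ofReal_trace_channel]
  calc ∫⁻ α, ∑' l, quadForm (M.effect l) (coherent α) * quadForm (M.prepared l) (coherent α) ∂p
      = ∑' l, ∫⁻ α, quadForm (M.effect l) (coherent α) *
          quadForm (M.prepared l) (coherent α) ∂p := lintegral_tsum fun l => by fun_prop
    _ ≤ ∑' l, benchmark p (fun k => q k) * ∑' k, q k * quadForm (M.effect l) (fock k) := by
        gcongr with l
        exact hp.lintegral_quadForm_mul_le q.apply_ne_top hB (M.isPOVM.isPositive l) (M.isState l)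
    _ = benchmark p fun k => q k := by
        rw [ENNReal.tsum_mul_left, ENNReal.tsum_comm]
        simp only [ENNReal.tsum_mul_left, M.tsum_quadForm_effect, hfock, mul_one, q.tsum_coe]

end UpperBound

section LowerBound

/-- The measure `d²β / π`, for which the coherent states resolve the identity. -/
def heterodyneMeasure : Measure ℂ := ENNReal.ofReal Real.pi⁻¹ • volume

instance : SFinite heterodyneMeasure := by
  unfold heterodyneMeasure
  infer_instance

theorem heterodyneMeasure_ne_top_of_isBounded {D : Set ℂ} (hD : Bornology.IsBounded D) :
    heterodyneMeasure D ≠ ∞ := by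
  rw [heterodyneMeasure, Measure.smul_apply, smul_eq_mul]
  exact ENNReal.mul_ne_top ENNReal.ofReal_ne_top hD.measure_lt_top.ne

theorem lintegral_enorm_inner_coherent_left_sq (x : FockSpace) :
    ∫⁻ β, ‖inner ℂ (coherent β) x‖ₑ ^ 2 ∂heterodyneMeasure = ‖x‖ₑ ^ 2 := by
  have hmoment (n : ℕ) : ∫⁻ β : ℂ, ENNReal.ofReal (Real.exp (-‖β‖ ^ 2)) * ‖β‖ₑ ^ (2 * n) =
      ENNReal.ofReal Real.pi * n.factorial := by
    have h := dampedMoment_volume one_pos n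
    simp only [dampedMoment, neg_one_mul, one_pow, div_one] at h
    rw [h, ENNReal.ofReal_mul Real.pi_nonneg, ENNReal.ofReal_natCast]
  have hpi : ENNReal.ofReal Real.pi⁻¹ * ENNReal.ofReal Real.pi = 1 := by
    rw [← ENNReal.ofReal_mul (by positivity), inv_mul_cancel₀ Real.pi_ne_zero, ENNReal.ofReal_one]
  rw [heterodyneMeasure, lintegral_smul_measure, smul_eq_mul]
  simp only [enorm_inner_comm (coherent _) x, enorm_inner_coherent_right_sq]
  rw [phaseInvariant_volume.lintegral_mul_enorm_powerSeries_sq (hasSum_bargmann x)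
    (w := fun t => ENNReal.ofReal (Real.exp (-t ^ 2))) (by fun_prop), ← ENNReal.tsum_mul_left,
    ← tsum_enorm_coord_sq]
  refine tsum_congr fun n => ?_
  have hn : (n.factorial : ℝ≥0∞) ≠ 0 := Nat.cast_ne_zero.2 n.factorial_ne_zero
  calc ENNReal.ofReal Real.pi⁻¹ * (‖bargmannCoeff x n‖ₑ ^ 2 *
        ∫⁻ β : ℂ, ENNReal.ofReal (Real.exp (-‖β‖ ^ 2)) * ‖β‖ₑ ^ (2 * n))
      = (ENNReal.ofReal Real.pi⁻¹ * ENNReal.ofReal Real.pi) *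
          (‖x n‖ₑ ^ 2 / n.factorial * n.factorial) := by
        rw [hmoment, enorm_bargmannCoeff_sq]
        ring
    _ = ‖x n‖ₑ ^ 2 := by
        rw [hpi, one_mul, ENNReal.div_mul_cancel hn (ENNReal.natCast_ne_top _)]

/-- The effect of heterodyne detection for an outcome in `D`. For `D` of infinite measure the
Bochner integral can be the junk value `0`. -/
def heterodyneEffect (D : Set ℂ) : Operator :=
  ∫ β in D, pureState (coherent β) ∂heterodyneMeasure

theorem integrableOn_pureState_coherent {D : Set ℂ} (hD : heterodyneMeasure D ≠ ∞) :
    IntegrableOn (fun β => pureState (coherent β)) D heterodyneMeasure :=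
  .of_bound hD.lt_top continuous_pureState_coherent.aestronglyMeasurable 1
    (ae_of_all _ fun β => (isState_pureState (norm_coherent β)).norm_le_one)

instance : IsOrderedModule ℝ Operator :=
  .of_smul_nonneg fun _ ha T hT => (nonneg_iff_isPositive _).2 <|
    ((nonneg_iff_isPositive T).1 hT).smul_of_nonneg (Complex.zero_le_real.2 ha)

theorem isPositive_heterodyneEffect (D : Set ℂ) : (heterodyneEffect D).IsPositive :=
  (nonneg_iff_isPositive _).1 <| integral_nonneg fun _ =>
    (nonneg_iff_isPositive _).2 (InnerProductSpace.isPositive_rankOne_self _)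

theorem quadForm_heterodyneEffect {D : Set ℂ} (hD : heterodyneMeasure D ≠ ∞) (x : FockSpace) :
    quadForm (heterodyneEffect D) x =
      ∫⁻ β in D, ‖inner ℂ (coherent β) x‖ₑ ^ 2 ∂heterodyneMeasure := by
  have hint := integrableOn_pureState_coherent hD
  have hx : Integrable (fun β => pureState (coherent β) x) (heterodyneMeasure.restrict D) :=
    (ContinuousLinearMap.apply ℂ FockSpace x).integrable_comp hint
  have hinner := hx.const_inner (𝕜 := ℂ) x
  simp only [← quadForm_rankOne_self]
  rw [quadForm, heterodyneEffect, integral_apply hint, ← integral_inner hx,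
    ← RCLike.re_eq_complex_re, ← integral_re hinner,
    ofReal_integral_eq_lintegral_ofReal hinner.re (ae_of_all _ fun β =>
      re_inner_apply_self_nonneg (InnerProductSpace.isPositive_rankOne_self _) x)]
  rfl

theorem tsum_setLIntegral_fiber {X : Type*} [MeasurableSpace X] (μ : Measure X) {J : X → ℕ}
    (hJ : Measurable J) (f : X → ℝ≥0∞) :
    ∑' l, ∫⁻ x in J ⁻¹' {l}, f x ∂μ = ∫⁻ x, f x ∂μ := by
  rw [← lintegral_iUnion (fun l => hJ (measurableSet_singleton l))
    (fun _ _ h => (Set.disjoint_singleton.2 h).preimage J), ← Set.preimage_iUnion,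
    Set.iUnion_of_singleton, Set.preimage_univ, Measure.restrict_univ]

variable {J : ℂ → ℕ}

/-- Heterodyne detection with outcomes coarse-grained by `J`, followed by the preparation of the
coherent state `|γ l⟩` upon outcome `l`. -/
def heterodyneMeasurePrepare (hJ : Measurable J)
    (hfin : ∀ l, heterodyneMeasure (J ⁻¹' {l}) ≠ ∞) (γ : ℕ → ℂ) : MeasurePrepare where
  effect l := heterodyneEffect (J ⁻¹' {l})
  prepared l := pureState (coherent (γ l))
  isPOVM := isPOVM_of_tsum_quadForm (fun _ => isPositive_heterodyneEffect _) fun x => by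
    simp only [quadForm_heterodyneEffect (hfin _)]
    rw [tsum_setLIntegral_fiber _ hJ, lintegral_enorm_inner_coherent_left_sq]
  isState l := isState_pureState (norm_coherent (γ l))

theorem ofReal_trace_heterodyneMeasurePrepare (hJ : Measurable J)
    (hfin : ∀ l, heterodyneMeasure (J ⁻¹' {l}) ≠ ∞) (γ : ℕ → ℂ) (α : ℂ) :
    ENNReal.ofReal (trace ((heterodyneMeasurePrepare hJ hfin γ).channel (pureState (coherent α)) *
        pureState (coherent α))).re =
      ∫⁻ β, ENNReal.ofReal (Real.exp (-‖β - α‖ ^ 2)) *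
        ENNReal.ofReal (Real.exp (-‖γ (J β) - α‖ ^ 2)) ∂heterodyneMeasure := by
  rw [MeasurePrepare.ofReal_trace_channel, ← tsum_setLIntegral_fiber _ hJ]
  refine tsum_congr fun l => ?_
  have hprepared : quadForm (pureState (coherent (γ l))) (coherent α) =
      ENNReal.ofReal (Real.exp (-‖γ l - α‖ ^ 2)) := by
    rw [pureState, quadForm_rankOne_self, enorm_inner_coherent_sq]
  simp only [heterodyneMeasurePrepare, quadForm_heterodyneEffect (hfin l), hprepared,
    enorm_inner_coherent_sq]
  rw [← lintegral_mul_const _ (by fun_prop)]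
  refine setLIntegral_congr_fun (hJ (measurableSet_singleton l)) fun β hβ => ?_
  simp only [Set.mem_singleton_iff.1 hβ]

theorem exists_measurable_dist_lt (X : Type*) [PseudoMetricSpace X] [Nonempty X]
    [TopologicalSpace.SeparableSpace X] [MeasurableSpace X] [OpensMeasurableSpace X] {ε : ℝ}
    (hε : 0 < ε) :
    ∃ (e : ℕ → X) (J : X → ℕ), Measurable J ∧ ∀ x, dist x (e (J x)) < ε := by
  classical
  obtain ⟨e, he⟩ := TopologicalSpace.exists_dense_seq X
  have hclose (x : X) : ∃ l, dist x (e l) < ε := he.exists_dist_lt x hε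
  exact ⟨e, fun x => Nat.find (hclose x),
    measurable_find hclose fun l => measurableSet_lt (by fun_prop) (by fun_prop),
    fun x => Nat.find_spec (hclose x)⟩

theorem lintegral_lintegral_le_of_tendsto {X Y : Type*} [MeasurableSpace X] [MeasurableSpace Y]
    {μ : Measure X} {ν : Measure Y} [SFinite ν] {F : ℕ → X → Y → ℝ≥0∞} {G : X → Y → ℝ≥0∞}
    {B : ℝ≥0∞} (hF : ∀ n, Measurable (Function.uncurry (F n)))
    (hlim : ∀ x y, Tendsto (fun n => F n x y) atTop (𝓝 (G x y)))
    (hB : ∀ n, ∫⁻ x, ∫⁻ y, F n x y ∂ν ∂μ ≤ B) : ∫⁻ x, ∫⁻ y, G x y ∂ν ∂μ ≤ B :=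
  calc ∫⁻ x, ∫⁻ y, G x y ∂ν ∂μ = ∫⁻ x, ∫⁻ y, liminf (fun n => F n x y) atTop ∂ν ∂μ :=
        lintegral_congr fun x => lintegral_congr fun y => (hlim x y).liminf_eq.symm
    _ ≤ ∫⁻ x, liminf (fun n => ∫⁻ y, F n x y ∂ν) atTop ∂μ :=
        lintegral_mono fun x => lintegral_liminf_le fun n => (hF n).of_uncurry_left
    _ ≤ liminf (fun n => ∫⁻ x, ∫⁻ y, F n x y ∂ν ∂μ) atTop :=
        lintegral_liminf_le fun n => (hF n).lintegral_prod_right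
    _ ≤ B := (liminf_le_liminf (Eventually.of_forall hB)).trans_eq (liminf_const B)

theorem lintegral_heterodyne_le_classicalFidelity (p : Measure ℂ) {γ : ℂ → ℂ}
    (hγ : Continuous γ) :
    ∫⁻ α, ∫⁻ β, ENNReal.ofReal (Real.exp (-‖β - α‖ ^ 2)) *
        ENNReal.ofReal (Real.exp (-‖γ β - α‖ ^ 2)) ∂heterodyneMeasure ∂p ≤
      classicalFidelity p coherent := by
  choose e J hJ hdist using fun n : ℕ =>
    exists_measurable_dist_lt ℂ (Nat.one_div_pos_of_nat (α := ℝ) (n := n))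
  have hfin (n l : ℕ) : heterodyneMeasure (J n ⁻¹' {l}) ≠ ∞ :=
    heterodyneMeasure_ne_top_of_isBounded <|
      (Metric.isBounded_ball (x := e n l) (r := 1 / (n + 1))).subset fun β hβ => hβ ▸ hdist n β
  have hcell (β : ℂ) : Tendsto (fun n => e n (J n β)) atTop (𝓝 β) :=
    tendsto_iff_dist_tendsto_zero.2 <| squeeze_zero (fun _ => dist_nonneg)
      (fun n => dist_comm β _ ▸ (hdist n β).le) tendsto_one_div_add_atTop_nhds_zero_nat
  refine lintegral_lintegral_le_of_tendsto
    (F := fun n α β => ENNReal.ofReal (Real.exp (-‖β - α‖ ^ 2)) *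
      ENNReal.ofReal (Real.exp (-‖γ (e n (J n β)) - α‖ ^ 2))) (fun n => ?_) (fun α β => ?_)
    fun n => ?_
  · have : Measurable fun β => γ (e n (J n β)) :=
      (measurable_of_countable fun l => γ (e n l)).comp (hJ n)
    unfold Function.uncurry
    fun_prop
  · have hcont : Continuous fun w : ℂ => ENNReal.ofReal (Real.exp (-‖γ w - α‖ ^ 2)) :=
      ENNReal.continuous_ofReal.comp (by fun_prop)
    exact ENNReal.Tendsto.const_mul ((hcont.tendsto β).comp (hcell β))
      (.inr ENNReal.ofReal_ne_top)
  · simp only [← ofReal_trace_heterodyneMeasurePrepare (hJ n) (hfin n) (fun l => γ (e n l))]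
    exact le_iSup (fun M : MeasurePrepare => ∫⁻ α, ENNReal.ofReal
      (trace (M.channel (pureState (coherent α)) * pureState (coherent α))).re ∂p) _

variable {r : ℝ}

theorem heterodyne_exponent (hr : 0 < r) (α β : ℂ) :
    -r * ‖α‖ ^ 2 + (-‖β - α‖ ^ 2 + -‖((1 + r)⁻¹ : ℝ) * β - α‖ ^ 2) =
      -(r / (1 + r)) * ‖β‖ ^ 2 + -(2 + r) * ‖α - ((1 + r)⁻¹ : ℝ) * β‖ ^ 2 := by
  simp only [Complex.sq_norm, Complex.normSq_apply, Complex.sub_re, Complex.sub_im,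
    Complex.re_ofReal_mul, Complex.im_ofReal_mul]
  field_simp
  ring

theorem lintegral_exp_neg_mul_norm_sq {b : ℝ} (hb : 0 < b) :
    ∫⁻ α : ℂ, ENNReal.ofReal (Real.exp (-b * ‖α‖ ^ 2)) = ENNReal.ofReal (Real.pi / b) := by
  simpa [dampedMoment] using dampedMoment_volume hb 0

theorem lintegral_heterodyne_gaussian_right (hr : 0 < r) (β : ℂ) :
    ∫⁻ α, ENNReal.ofReal (Real.exp (-‖β - α‖ ^ 2)) *
        ENNReal.ofReal (Real.exp (-‖((1 + r)⁻¹ : ℝ) * β - α‖ ^ 2)) ∂gaussian r =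
      ENNReal.ofReal (r / (2 + r)) *
        ENNReal.ofReal (Real.exp (-(r / (1 + r)) * ‖β‖ ^ 2)) := by
  have hsquare (α : ℂ) : ENNReal.ofReal (r / Real.pi * Real.exp (-r * ‖α‖ ^ 2)) *
      (ENNReal.ofReal (Real.exp (-‖β - α‖ ^ 2)) *
        ENNReal.ofReal (Real.exp (-‖((1 + r)⁻¹ : ℝ) * β - α‖ ^ 2))) =
      ENNReal.ofReal (r / Real.pi) * (ENNReal.ofReal (Real.exp (-(r / (1 + r)) * ‖β‖ ^ 2)) *
        ENNReal.ofReal (Real.exp (-(2 + r) * ‖α - ((1 + r)⁻¹ : ℝ) * β‖ ^ 2))) := by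
    rw [ENNReal.ofReal_mul (by positivity), mul_assoc]
    simp only [← ENNReal.ofReal_mul (Real.exp_nonneg _), ← Real.exp_add]
    rw [heterodyne_exponent hr]
  have hshift :
      ∫⁻ α : ℂ, ENNReal.ofReal (Real.exp (-(2 + r) * ‖α - ((1 + r)⁻¹ : ℝ) * β‖ ^ 2)) =
        ENNReal.ofReal (Real.pi / (2 + r)) := by
    rw [lintegral_sub_right_eq_self
      (fun α : ℂ => ENNReal.ofReal (Real.exp (-(2 + r) * ‖α‖ ^ 2))),
      lintegral_exp_neg_mul_norm_sq (by positivity)]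
  have hconst : r / Real.pi * (Real.pi / (2 + r)) = r / (2 + r) := by field_simp
  rw [gaussian, lintegral_withDensity_eq_lintegral_mul _ (by fun_prop) (by fun_prop)]
  simp only [Pi.mul_apply, hsquare]
  rw [lintegral_const_mul _ (by fun_prop), lintegral_const_mul _ (by fun_prop), hshift,
    mul_left_comm, ← ENNReal.ofReal_mul (by positivity), hconst, mul_comm]

theorem lintegral_heterodyne_gaussian (hr : 0 < r) :
    ∫⁻ α, ∫⁻ β, ENNReal.ofReal (Real.exp (-‖β - α‖ ^ 2)) *
        ENNReal.ofReal (Real.exp (-‖((1 + r)⁻¹ : ℝ) * β - α‖ ^ 2)) ∂heterodyneMeasure ∂gaussian r =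
      ENNReal.ofReal ((1 + r) / (2 + r)) := by
  have := isProbabilityMeasure_gaussian hr
  rw [lintegral_lintegral_swap (by fun_prop)]
  simp only [lintegral_heterodyne_gaussian_right hr]
  rw [lintegral_const_mul _ (by fun_prop), heterodyneMeasure, lintegral_smul_measure, smul_eq_mul,
    lintegral_exp_neg_mul_norm_sq (by positivity), ← ENNReal.ofReal_mul (by positivity),
    ← ENNReal.ofReal_mul (by positivity)]
  congr 1
  field_simp

theorem le_classicalFidelity_gaussian (hr : 0 < r) :
    ENNReal.ofReal ((1 + r) / (2 + r)) ≤ classicalFidelity (gaussian r) coherent :=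
  (lintegral_heterodyne_gaussian hr).ge.trans
    (lintegral_heterodyne_le_classicalFidelity _ (by fun_prop))

end LowerBound

end CoherentTeleportation

end

theorem mainTheorem5 :
    (∀ (p : Measure ℂ) [IsProbabilityMeasure p], CoherentTeleportation.PhaseInvariant p →
      CoherentTeleportation.classicalFidelity p CoherentTeleportation.coherent
          ≤ (⨅ q : PMF ℕ, CoherentTeleportation.benchmark p (fun k => q k)) ∧
      (⨅ q : PMF ℕ, CoherentTeleportation.benchmark p (fun k => q k))
          ≤ CoherentTeleportation.benchmark p
              (fun k => ENNReal.ofReal (CoherentTeleportation.nu p k))) ∧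
    (∀ r : ℝ, 0 < r →
      IsProbabilityMeasure (CoherentTeleportation.gaussian r) ∧
      CoherentTeleportation.PhaseInvariant (CoherentTeleportation.gaussian r) ∧
      CoherentTeleportation.classicalFidelity (CoherentTeleportation.gaussian r)
          CoherentTeleportation.coherent = ENNReal.ofReal ((1 + r) / (2 + r)) ∧
      (⨅ q : PMF ℕ, CoherentTeleportation.benchmark (CoherentTeleportation.gaussian r)
          (fun k => q k)) = ENNReal.ofReal ((1 + r) / (2 + r)) ∧
      CoherentTeleportation.benchmark (CoherentTeleportation.gaussian r)
          (fun k => ENNReal.ofReal (CoherentTeleportation.nu (CoherentTeleportation.gaussian r) k))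
        = ENNReal.ofReal ((1 + r) / (2 + r))) := by
  refine ⟨fun p _ hp => ⟨le_iInf fun q => hp.classicalFidelity_coherent_le q,
    CoherentTeleportation.iInf_benchmark_le p⟩, fun r hr => ?_⟩
  have hprob := CoherentTeleportation.isProbabilityMeasure_gaussian hr
  have hphase := CoherentTeleportation.phaseInvariant_gaussian r
  have hbench := CoherentTeleportation.benchmark_gaussian hr
  have hlower := CoherentTeleportation.le_classicalFidelity_gaussian hr
  have hfid : CoherentTeleportation.classicalFidelity (CoherentTeleportation.gaussian r)
      CoherentTeleportation.coherent ≤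
      ⨅ q : PMF ℕ, CoherentTeleportation.benchmark (CoherentTeleportation.gaussian r)
        (fun k => q k) :=
    le_iInf fun q => hphase.classicalFidelity_coherent_le q
  have hinf := (CoherentTeleportation.iInf_benchmark_le (CoherentTeleportation.gaussian r)).trans
    hbench.le
  exact ⟨hprob, hphase, le_antisymm (hfid.trans hinf) hlower,
    le_antisymm hinf (hlower.trans hfid), hbench⟩
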